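/- **Theorem 1.** Let $c\in[1,\infty)$ and let $(p_n)_{n\ge 1}$ be non-negative integers with $p_n/n\to c$. There is a constant $C$, depending only on $c$ and $(p_n)$, such that the following holds. For each $n$ let $\beta=\beta_n\in\mathbb{R}^{p_n}$ and $\sigma^2=\sigma_n^2\ge 0$ with $\|\beta_n\|^2$ and $\sigma_n^2$ bounded in $n$. Let $X$ be an $n\times p_n$ random matrix with independent rows $x_1,\dots,x_n\sim N(0,I)$, and given $X$ let $Y=(y_1,\dots,y_n)$ have independent coordinates $y_i\sim N(\beta^Tx_i,\sigma^2)$. Write $\mu=X\beta\in\mathbb{R}^n$, write ${\rm pr}_X$ for the conditional probability given $X$, and let $$\hat\sigma^2_{Dicker}=\frac{p_n+n+1}{n(n+1)}\|Y\|^2-\frac{1}{n(n+1)}\|X^TY\|^2 .$$ Then there are measurable sets $A_n$ of real $n\times p_n$ matrices with ${\rm pr}(X\in A_n)\to1$ as $n\to\infty$ such that: 1. for all $n\ge1$, $X\in A_n$ and $\xi>0$, $${\rm pr}_X\left(|\hat\sigma^2_{Dicker}-\sigma^2|\ge\xi\right)\le C\,\frac{g(c,n,\mu,\sigma^2)}{\xi^2\sqrt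 n},$$ where $$g(c,n,\mu,\sigma^2)=1+2(c+1)\left\{\left(\tfrac1n\|\mu\|^2\right)^2+\sigma^4\right\}+\tfrac{4\sigma^2}{n}\|\mu\|^2+2\sigma^4;$$ 2. if $0\le\sigma_0^2<\sigma_1^2$ are fixed numbers (the two candidate variances), $J\in\{0,1\}$, and the true variance is $\sigma^2=\sigma_J^2$ for every $n$, then the conditional error $R={\rm pr}_X(\delta\ne J)$ of the rule $\delta$ that equals $1$ if $\hat\sigma^2_{Dicker}>(\sigma_0^2+\sigma_1^2)/2$ and $0$ otherwise satisfies $R\le K/\sqrt n$ for all $n\ge1$ and $X\in A_n$, with a constant $K$ that does not depend on $n$ or $X$; in particular ${\rm pr}(R\le\varepsilon)\to1$ as $n\to\infty$ for every $\varepsilon>0$. -/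

import Mathlib

open MeasureTheory ProbabilityTheory Filter Topology
open scoped NNReal Matrix

noncomputable section

/-- The squared Euclidean norm of a finite real vector. -/
def sqNorm {m : ℕ} (v : Fin m → ℝ) : ℝ := ∑ i, v i ^ 2

theorem sqNorm_eq_norm_sq {m : ℕ} (v : Fin m → ℝ) :
    sqNorm v = ‖(WithLp.toLp 2 v : EuclideanSpace ℝ (Fin m))‖ ^ 2 := by
  simp [sqNorm, EuclideanSpace.norm_sq_eq]

/-- The (Borel) product sigma-algebra on real matrices, that is, on functions of the two indices. -/
instance instMeasurableSpaceRealMatrix (n p : ℕ) : MeasurableSpace (Matrix (Fin n) (Fin p) ℝ) :=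
  inferInstanceAs (MeasurableSpace (Fin n → Fin p → ℝ))

/-- The law of the design matrix `X`: its `n` rows `x₁, …, xₙ` are independent, each with the
standard normal distribution `N(0, I)` on `ℝᵖ`. -/
def designLaw (n p : ℕ) : Measure (Matrix (Fin n) (Fin p) ℝ) :=
  Measure.pi fun _ : Fin n => Measure.pi fun _ : Fin p => gaussianReal 0 1

instance instIsProbabilityMeasureDesignLaw (n p : ℕ) : IsProbabilityMeasure (designLaw n p) :=
  inferInstanceAs (IsProbabilityMeasure
    (Measure.pi fun _ : Fin n => Measure.pi fun _ : Fin p => gaussianReal 0 1))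

/-- The conditional law `pr_X` of the responses `Y = (y₁, …, yₙ)` given the design matrix `X`:
independent coordinates with `yᵢ ~ N(βᵀxᵢ, s)`, where `s` is the noise variance. -/
def condLaw {n p : ℕ} (X : Matrix (Fin n) (Fin p) ℝ) (β : Fin p → ℝ) (s : ℝ≥0) :
    Measure (Fin n → ℝ) :=
  Measure.pi fun i => gaussianReal ((X *ᵥ β) i) s

instance instIsProbabilityMeasureCondLaw {n p : ℕ} (X : Matrix (Fin n) (Fin p) ℝ)
    (β : Fin p → ℝ) (s : ℝ≥0) : IsProbabilityMeasure (condLaw X β s) :=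
  inferInstanceAs (IsProbabilityMeasure (Measure.pi fun i => gaussianReal ((X *ᵥ β) i) s))

/-- Dicker's estimator of the noise variance. -/
def dickerEstimator {n p : ℕ} (X : Matrix (Fin n) (Fin p) ℝ) (Y : Fin n → ℝ) : ℝ :=
  ((p : ℝ) + n + 1) / ((n : ℝ) * (n + 1)) * sqNorm Y
    - 1 / ((n : ℝ) * (n + 1)) * sqNorm (Xᵀ *ᵥ Y)

/-- `g(c, n, μ, σ²) = 1 + 2(c+1){(‖μ‖²/n)² + σ⁴} + (4σ²/n)‖μ‖² + 2σ⁴`, with `s = σ²`. -/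
def gBound (c : ℝ) (n : ℕ) (μ : Fin n → ℝ) (s : ℝ) : ℝ :=
  1 + 2 * (c + 1) * ((1 / (n : ℝ) * sqNorm μ) ^ 2 + s ^ 2)
    + 4 * s / (n : ℝ) * sqNorm μ + 2 * s ^ 2

/-- The threshold rule for deciding between the noise variances `s₀ < s₁`, based on Dicker's
estimator. -/
def dickerRule {n p : ℕ} (s₀ s₁ : ℝ≥0) (X : Matrix (Fin n) (Fin p) ℝ) (Y : Fin n → ℝ) : Fin 2 :=
  if ((s₀ : ℝ) + s₁) / 2 < dickerEstimator X Y then 1 else 0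

/-- The conditional error `pr_X(δ ≠ J)` of the threshold rule `δ` when the true noise variance
is `s_J`. -/
def dickerRuleError {n p : ℕ} (s₀ s₁ : ℝ≥0) (J : Fin 2) (β : Fin p → ℝ)
    (X : Matrix (Fin n) (Fin p) ℝ) : ℝ :=
  (condLaw X β (![s₀, s₁] J)).real {Y | dickerRule s₀ s₁ X Y ≠ J}

end

/-! The theorem reduces to one estimate: the unconditional mean square error of Dicker's estimator
is `O(1/n)`. Let `A n` be the set of designs whose conditional mean square error is at most `1/√n`.
Markov's inequality over the design gives its complement probability `O(1/√n)`; Chebyshev's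
inequality given `X ∈ A n` bounds the deviation probability by `1/(ξ²√n)`. Since `gBound` is at
least 1, `C = 1` suffices. A wrong decision forces a deviation of at least half the gap between the
two variances.

For the mean square error, the pairs zᵢ = (xᵢ, eᵢ) of row and standardised noise are i.i.d., and
v(zᵢ) = yᵢxᵢ - β is centred. Expanding ‖XᵀY‖² = ‖∑ v(zᵢ) + nβ‖² turns the error into -1/(n(n+1))
times ∑ f(zᵢ) + ∑_{i≠j} ⟨v(zᵢ), v(zⱼ)⟩ with f centred (`dickerEstimator_sub_eq`). Revealing the
points one at a time makes this sum a martingale, which bounds its second moment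
(`integral_pairStat_sq_le`). The off-diagonal part costs n² times the norm of the covariance of v,
bounded independently of p, times its trace, of order p; the diagonal costs n(p+n+1)². After
division by n²(n+1)² both are `O(1/n)`, because p/n is bounded. -/

theorem MeasureTheory.MemLp.mul_prod_two {α β : Type*} [MeasurableSpace α] [MeasurableSpace β]
    {μ : Measure α} {ν : Measure β} [SFinite μ] [SFinite ν] {f : α → ℝ} {g : β → ℝ}
    (hf : MemLp f 2 μ) (hg : MemLp g 2 ν) :
    MemLp (fun z : α × β => f z.1 * g z.2) 2 (μ.prod ν) := by
  have hm : AEStronglyMeasurable (fun z : α × β => f z.1 * g z.2) (μ.prod ν) :=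
    hf.1.comp_fst.mul hg.1.comp_snd
  rw [memLp_two_iff_integrable_sq hm]
  simpa only [mul_pow] using hf.integrable_sq.mul_prod hg.integrable_sq

/-! ### Second moments of degenerate second-order statistics. -/

section UStatistic

variable {E κ : Type*} [Fintype κ]

/-- The degenerate second-order statistic `∑ᵢ f(zᵢ) + ∑_{i ≠ j} ⟨v(zᵢ), v(zⱼ)⟩`. -/
def pairStat (f : E → ℝ) (v : E → κ → ℝ) {n : ℕ} (z : Fin n → E) : ℝ :=
  ∑ i, f (z i) + (∑ k, (∑ i, v (z i) k) ^ 2 - ∑ i, ∑ k, v (z i) k ^ 2)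

/-- The martingale increment: given the earlier points `z`, the added term is centred in the fresh
point `a` as soon as `f` and `v` are. -/
theorem pairStat_cons (f : E → ℝ) (v : E → κ → ℝ) {n : ℕ} (a : E) (z : Fin n → E) :
    pairStat f v (Fin.cons a z : Fin (n + 1) → E) =
      pairStat f v z + (f a + 2 * ∑ k, v a k * ∑ i, v (z i) k) := by
  simp only [pairStat, Fin.sum_univ_succ, Fin.cons_zero, Fin.cons_succ, add_sq,
    Finset.sum_add_distrib, Finset.mul_sum, mul_assoc]
  ring

variable [MeasurableSpace E] {ν : Measure E} [IsProbabilityMeasure ν]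

theorem measurePreserving_finCons (n : ℕ) :
    MeasurePreserving (fun q : E × (Fin n → E) => (Fin.cons q.1 q.2 : Fin (n + 1) → E))
      (ν.prod (Measure.pi fun _ => ν)) (Measure.pi fun _ => ν) := by
  have h := (measurePreserving_piFinSuccAbove (fun _ : Fin (n + 1) => ν) 0).symm
  simpa [MeasurableEquiv.piFinSuccAbove_symm_apply, Fin.insertNthEquiv, Fin.insertNth_zero] using h

theorem measurableEmbedding_finCons (n : ℕ) :
    MeasurableEmbedding (fun q : E × (Fin n → E) => (Fin.cons q.1 q.2 : Fin (n + 1) → E)) := by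
  have h := (MeasurableEquiv.piFinSuccAbove (fun _ : Fin (n + 1) => E) 0).symm.measurableEmbedding
  simpa [MeasurableEquiv.piFinSuccAbove_symm_apply, Fin.insertNthEquiv, Fin.insertNth_zero] using h

theorem integral_add_const_sq {g : E → ℝ} (hg : MemLp g 2 ν) (hg0 : ∫ a, g a ∂ν = 0) (r : ℝ) :
    ∫ a, (r + g a) ^ 2 ∂ν = r ^ 2 + ∫ a, g a ^ 2 ∂ν := by
  have hi := hg.integrable (by norm_num)
  have : ∀ a, (r + g a) ^ 2 = r ^ 2 + (2 * r) * g a + g a ^ 2 := fun a => by ring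
  simp_rw [this]
  rw [integral_add (by fun_prop) hg.integrable_sq, integral_add (by fun_prop) (by fun_prop),
    integral_const_mul, hg0]
  simp

variable {f : E → ℝ} {v : E → κ → ℝ}

theorem memLp_sum_eval {g : E → ℝ} (hg : MemLp g 2 ν) (n : ℕ) :
    MemLp (fun z : Fin n → E => ∑ i, g (z i)) 2 (Measure.pi fun _ => ν) :=
  memLp_finsetSum _ fun i _ =>
    hg.comp_measurePreserving (measurePreserving_eval (fun _ : Fin n => ν) i)

theorem integral_sum_eval_sq {g : E → ℝ} (hg : MemLp g 2 ν) (hg0 : ∫ a, g a ∂ν = 0) (n : ℕ) :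
    ∫ z : Fin n → E, (∑ i, g (z i)) ^ 2 ∂(Measure.pi fun _ => ν) = n * ∫ a, g a ^ 2 ∂ν := by
  induction n with
  | zero => simp
  | succ n ih =>
    rw [← (measurePreserving_finCons n).integral_comp (measurableEmbedding_finCons n),
      integral_prod_symm]
    · simp only [Fin.sum_univ_succ, Fin.cons_zero, Fin.cons_succ]
      simp_rw [add_comm (g _), integral_add_const_sq hg hg0]
      rw [integral_add (memLp_sum_eval hg n).integrable_sq (integrable_const _), ih]
      simp
      ring
    · exact ((measurePreserving_finCons n).integrable_comp_emb (measurableEmbedding_finCons n)).2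
        (memLp_sum_eval hg (n + 1)).integrable_sq

theorem memLp_pairStat (hf : MemLp f 2 ν) (hv : ∀ k, MemLp (fun a => v a k) 2 ν) (n : ℕ) :
    MemLp (fun z : Fin n → E => pairStat f v z) 2 (Measure.pi fun _ => ν) := by
  induction n with
  | zero => simp [pairStat]
  | succ n ih =>
    rw [← (measurePreserving_finCons n).map_eq, (measurableEmbedding_finCons n).memLp_map_measure_iff]
    simp only [Function.comp_def, pairStat_cons]
    refine (ih.comp_snd ν).add ((hf.comp_fst _).add (MemLp.const_mul ?_ 2))
    exact memLp_finsetSum _ fun k _ => (hv k).mul_prod_two (memLp_sum_eval (hv k) n)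

/-- Second moment of a degenerate second-order statistic of an i.i.d. sample. -/
theorem integral_pairStat_sq_le (hf : MemLp f 2 ν) (hf0 : ∫ a, f a ∂ν = 0)
    (hv : ∀ k, MemLp (fun a => v a k) 2 ν) (hv0 : ∀ k, ∫ a, v a k ∂ν = 0)
    {L B : ℝ} (hL0 : 0 ≤ L) (hL : ∀ u : κ → ℝ, ∫ a, (∑ k, v a k * u k) ^ 2 ∂ν ≤ L * ∑ k, u k ^ 2)
    (hB : ∑ k, ∫ a, v a k ^ 2 ∂ν ≤ B) (n : ℕ) :
    ∫ z : Fin n → E, pairStat f v z ^ 2 ∂(Measure.pi fun _ => ν) ≤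
      2 * n * ∫ a, f a ^ 2 ∂ν + 4 * n ^ 2 * L * B := by
  have hB0 : 0 ≤ B := (Finset.sum_nonneg fun k _ => integral_nonneg fun a => sq_nonneg _).trans hB
  induction n with
  | zero => simp [pairStat]
  | succ n ih =>
    rw [← (measurePreserving_finCons n).integral_comp (measurableEmbedding_finCons n),
      integral_prod_symm]
    swap
    · exact ((measurePreserving_finCons n).integrable_comp_emb (measurableEmbedding_finCons n)).2
        (memLp_pairStat hf hv (n + 1)).integrable_sq
    have hlin : ∀ u : κ → ℝ, MemLp (fun a => ∑ k, v a k * u k) 2 ν := fun u =>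
      memLp_finsetSum _ fun k _ => (hv k).mul_const (u k)
    have hlin0 : ∀ u : κ → ℝ, ∫ a, ∑ k, v a k * u k ∂ν = 0 := fun u => by
      rw [integral_finsetSum _ fun k _ => ((hv k).mul_const (u k)).integrable (by norm_num)]
      simp [integral_mul_const, hv0]
    -- Integrating the fresh point first kills the cross term with the past; (f + 2w)² ≤ 2f² + 8w²
    -- and `hL` then bound the squared increment.
    have hint : ∀ z : Fin n → E,
        ∫ a, pairStat f v (Fin.cons a z : Fin (n + 1) → E) ^ 2 ∂ν ≤
          pairStat f v z ^ 2 +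
            (2 * ∫ a, f a ^ 2 ∂ν + 8 * L * ∑ k, (∑ i, v (z i) k) ^ 2) := by
      intro z
      have hg : MemLp (fun a => f a + 2 * ∑ k, v a k * ∑ i, v (z i) k) 2 ν :=
        hf.add ((hlin _).const_mul 2)
      simp_rw [pairStat_cons]
      rw [integral_add_const_sq hg]
      · gcongr
        calc _ ≤ ∫ a, (2 * f a ^ 2 + 8 * (∑ k, v a k * ∑ i, v (z i) k) ^ 2) ∂ν := by
              refine integral_mono hg.integrable_sq
                ((hf.integrable_sq.const_mul 2).add ((hlin _).integrable_sq.const_mul 8)) fun a => ?_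
              nlinarith [sq_nonneg (f a - 2 * ∑ k, v a k * ∑ i, v (z i) k)]
          _ ≤ _ := by
              rw [integral_add (hf.integrable_sq.const_mul 2) ((hlin _).integrable_sq.const_mul 8),
                integral_const_mul, integral_const_mul]
              linarith [hL fun k => ∑ i, v (z i) k]
      · rw [integral_add (hf.integrable (by norm_num))
          (((hlin _).const_mul 2).integrable (by norm_num)), integral_const_mul, hf0, hlin0]
        simp
    have hS : Integrable (fun z : Fin n → E => ∑ k, (∑ i, v (z i) k) ^ 2) (Measure.pi fun _ => ν) :=
      integrable_finsetSum _ fun k _ => (memLp_sum_eval (hv k) n).integrable_sq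
    have hSB : ∫ z : Fin n → E, ∑ k, (∑ i, v (z i) k) ^ 2 ∂(Measure.pi fun _ => ν) ≤ n * B := by
      rw [integral_finsetSum _ fun k _ => (memLp_sum_eval (hv k) n).integrable_sq]
      simp_rw [integral_sum_eval_sq (hv _) (hv0 _), ← Finset.mul_sum]
      gcongr
    have hI : Integrable (fun z : Fin n → E =>
        2 * ∫ a, f a ^ 2 ∂ν + 8 * L * ∑ k, (∑ i, v (z i) k) ^ 2) (Measure.pi fun _ => ν) :=
      (integrable_const _).add (hS.const_mul _)
    calc _ ≤ ∫ z : Fin n → E, (pairStat f v z ^ 2 +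
            (2 * ∫ a, f a ^ 2 ∂ν + 8 * L * ∑ k, (∑ i, v (z i) k) ^ 2)) ∂(Measure.pi fun _ => ν) := by
          refine integral_mono_of_nonneg (ae_of_all _ fun z => integral_nonneg fun a => sq_nonneg _)
            ((memLp_pairStat hf hv n).integrable_sq.add hI) (ae_of_all _ hint)
      _ = _ := by
          rw [integral_add (memLp_pairStat hf hv n).integrable_sq hI,
            integral_add (integrable_const _) (hS.const_mul _), integral_const_mul (8 * L)]
      _ ≤ _ := by
          simp only [integral_const, probReal_univ, one_smul]
          have := mul_le_mul_of_nonneg_left hSB (by positivity : 0 ≤ 8 * L)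
          have h2 : 0 ≤ L * B := by positivity
          push_cast
          -- The new off-diagonal cost is 8nLB, while 4(n+1)² - 4n² = 8n + 4.
          nlinarith

end UStatistic

theorem MeasureTheory.Integrable.fun_sub {α : Type*} [MeasurableSpace α] {μ : Measure α}
    {f g : α → ℝ} (hf : Integrable f μ) (hg : Integrable g μ) : Integrable (fun a => f a - g a) μ :=
  hf.sub hg

/-! ### Gaussian moments and linear forms. -/

theorem integral_pow_two_stdGaussian : ∫ x, x ^ 2 ∂gaussianReal 0 1 = 1 := by
  have h := variance_fun_id_gaussianReal (μ := 0) (v := 1)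
  rw [variance_of_integral_eq_zero (by fun_prop) (by simp)] at h
  simpa using h

/-- Four derivatives at 0 of the moment generating function exp(t²/2); `hstep` tracks the polynomial
factor, q ↦ tq + q'. -/
theorem integral_pow_four_stdGaussian : ∫ x, x ^ 4 ∂gaussianReal 0 1 = 3 := by
  have h := iteratedDeriv_mgf_zero (X := fun x : ℝ => x) (μ := gaussianReal 0 1) (by simp) 4
  have hexp : ∀ t : ℝ, HasDerivAt (fun t : ℝ => Real.exp (t ^ 2 / 2)) (Real.exp (t ^ 2 / 2) * t) t :=
    fun t => by simpa using ((hasDerivAt_id t).pow 2 |>.div_const 2).exp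
  have hstep : ∀ q q' : ℝ → ℝ, (∀ t, HasDerivAt q (q' t) t) →
      deriv (fun t : ℝ => Real.exp (t ^ 2 / 2) * q t) =
        fun t => Real.exp (t ^ 2 / 2) * (t * q t + q' t) := fun q q' hq => by
    funext t
    rw [((hexp t).fun_mul (hq t)).deriv]
    ring
  have h1 : deriv (fun t : ℝ => Real.exp (t ^ 2 / 2)) = fun t => Real.exp (t ^ 2 / 2) * t :=
    funext fun t => (hexp t).deriv
  have h2 := hstep (fun t => t) (fun _ => 1) (fun t => hasDerivAt_id t)
  have h3 := hstep (fun t => t * t + 1) (fun t => 2 * t) fun t => by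
    exact (((hasDerivAt_id t).fun_mul (hasDerivAt_id t)).add_const 1).congr_deriv
      (by simp only [id]; ring)
  have h4 := hstep (fun t => t * (t * t + 1) + 2 * t) (fun t => 3 * t ^ 2 + 3) fun t => by
    exact (((hasDerivAt_id t).fun_mul
      (((hasDerivAt_id t).fun_mul (hasDerivAt_id t)).add_const 1)).fun_add
      ((hasDerivAt_id t).const_mul 2)).congr_deriv (by simp only [id]; ring)
  rw [mgf_fun_id_gaussianReal] at h
  simp only [zero_mul, zero_add, NNReal.coe_one, one_mul, iteratedDeriv_succ, iteratedDeriv_zero]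
    at h
  rw [h1, h2, h3, h4] at h
  simpa using h.symm

theorem integral_pow_gaussianReal_zero (v : ℝ≥0) (m : ℕ) :
    ∫ x, x ^ (2 * m) ∂gaussianReal 0 v = (v : ℝ) ^ m * ∫ x, x ^ (2 * m) ∂gaussianReal 0 1 := by
  have h : gaussianReal 0 v = (gaussianReal 0 1).map (√(v : ℝ) * ·) := by
    rw [gaussianReal_map_const_mul]
    congr 1
    · simp
    · ext; simp
  rw [h, integral_map (by fun_prop) (by fun_prop)]
  simp_rw [mul_pow, integral_const_mul]
  rw [pow_mul √(v : ℝ), Real.sq_sqrt v.coe_nonneg]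

theorem map_dotProduct_stdGaussian {p : ℕ} (u : Fin p → ℝ) :
    (Measure.pi fun _ : Fin p => gaussianReal 0 1).map (fun x => u ⬝ᵥ x) =
      gaussianReal 0 (sqNorm u).toNNReal := by
  have h : (fun x : Fin p → ℝ => u ⬝ᵥ x) =
      innerSL ℝ (WithLp.toLp 2 u : EuclideanSpace ℝ (Fin p)) ∘ WithLp.toLp 2 := by
    ext x
    simp [dotProduct, PiLp.inner_apply, mul_comm]
  rw [h, ← Measure.map_map (by fun_prop) (by fun_prop), map_pi_eq_stdGaussian,
    IsGaussian.map_eq_gaussianReal, variance_dual_stdGaussian, integral_strongDual_stdGaussian,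
    innerSL_apply_norm, sqNorm_eq_norm_sq]

/-- The joint law of a row of the design matrix and of the standardised noise attached to it. -/
noncomputable abbrev rowLaw (p : ℕ) : Measure ((Fin p → ℝ) × ℝ) :=
  (Measure.pi fun _ : Fin p => gaussianReal 0 1).prod (gaussianReal 0 1)

/-- The linear form `(x, e) ↦ ⟨u, x⟩ + t e`. -/
def rowForm {p : ℕ} (u : Fin p → ℝ) (t : ℝ) (z : (Fin p → ℝ) × ℝ) : ℝ := u ⬝ᵥ z.1 + t * z.2

@[fun_prop]
theorem measurable_rowForm {p : ℕ} (u : Fin p → ℝ) (t : ℝ) : Measurable (rowForm u t) := by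
  unfold rowForm dotProduct
  fun_prop

section RowForm

variable {p : ℕ} (u u' : Fin p → ℝ) (t t' : ℝ)

theorem map_rowForm :
    (rowLaw p).map (rowForm u t) = gaussianReal 0 (sqNorm u + t ^ 2).toNNReal := by
  have hs : 0 ≤ sqNorm u := Finset.sum_nonneg fun i _ => sq_nonneg _
  have hm : Measurable fun x : Fin p → ℝ => u ⬝ᵥ x := by unfold dotProduct; fun_prop
  have h := gaussianReal_add_gaussianReal_of_indepFun
    (P := rowLaw p) (X := fun z => u ⬝ᵥ z.1) (Y := fun z => t * z.2)
    (m₁ := 0) (m₂ := 0) (v₁ := (sqNorm u).toNNReal) (v₂ := (t ^ 2).toNNReal)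
    (indepFun_prod hm (by fun_prop)) ?_ ?_
  · rw [Real.toNNReal_add hs (sq_nonneg t)]
    simpa using! h
  · have h := Measure.map_map (μ := rowLaw p) hm measurable_fst
    rw [Measure.map_fst_prod, measure_univ, one_smul, map_dotProduct_stdGaussian] at h
    exact h.symm
  · have h := Measure.map_map (μ := rowLaw p) (measurable_const_mul t) measurable_snd
    rw [Measure.map_snd_prod, measure_univ, one_smul, gaussianReal_map_const_mul, mul_zero,
      mul_one] at h
    rw [Real.toNNReal_of_nonneg (sq_nonneg t)]
    exact h.symm

theorem memLp_rowForm (q : ENNReal) (hq : q ≠ ⊤) : MemLp (rowForm u t) q (rowLaw p) := by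
  have h := memLp_id_gaussianReal' (μ := 0) (v := (sqNorm u + t ^ 2).toNNReal) q hq
  rw [← map_rowForm, memLp_map_measure_iff (by fun_prop) (by fun_prop)] at h
  exact h

theorem integral_rowForm_pow (m : ℕ) :
    ∫ z, rowForm u t z ^ (2 * m) ∂rowLaw p =
      (sqNorm u + t ^ 2) ^ m * ∫ x, x ^ (2 * m) ∂gaussianReal 0 1 := by
  have hs : 0 ≤ sqNorm u := Finset.sum_nonneg fun i _ => sq_nonneg _
  have h := integral_pow_gaussianReal_zero (sqNorm u + t ^ 2).toNNReal m
  rwa [← map_rowForm, integral_map (by fun_prop) (by fun_prop), Real.coe_toNNReal _ (by positivity)]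
    at h

theorem integrable_rowForm_pow_mul_pow (a b : ℕ) :
    Integrable (fun z => rowForm u t z ^ a * rowForm u' t' z ^ b) (rowLaw p) := by
  have h : ∀ (u : Fin p → ℝ) t (a : ℕ), MemLp (fun z => rowForm u t z ^ a) 2 (rowLaw p) := by
    intro u t a
    rw [memLp_two_iff_integrable_sq (by fun_prop)]
    simp_rw [← pow_mul]
    rcases Nat.eq_zero_or_pos (a * 2) with h0 | h0
    · simp [h0]
    · exact ((memLp_rowForm u t (a * 2 : ℕ) (ENNReal.natCast_ne_top _)).integrable_norm_pow h0.ne').mono'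
        (by fun_prop) (ae_of_all _ fun z => by simp)
  exact (h u t a).integrable_mul (h u' t' b)

theorem rowForm_add (z : (Fin p → ℝ) × ℝ) :
    rowForm (u + u') (t + t') z = rowForm u t z + rowForm u' t' z := by
  simp [rowForm, add_dotProduct]; ring

theorem rowForm_sub (z : (Fin p → ℝ) × ℝ) :
    rowForm (u - u') (t - t') z = rowForm u t z - rowForm u' t' z := by
  simp [rowForm, sub_dotProduct]; ring

theorem sqNorm_add : sqNorm (u + u') = sqNorm u + 2 * u ⬝ᵥ u' + sqNorm u' := by
  simp [sqNorm, dotProduct, add_sq, Finset.sum_add_distrib, Finset.mul_sum, mul_assoc]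

theorem sqNorm_sub : sqNorm (u - u') = sqNorm u - 2 * u ⬝ᵥ u' + sqNorm u' := by
  simp [sqNorm, dotProduct, sub_sq, Finset.sum_add_distrib, Finset.sum_sub_distrib, Finset.mul_sum,
    mul_assoc]

/-- Polarisation: sums and differences of row forms are again row forms, so only single-form moments
are needed. -/
theorem integral_rowForm_mul :
    ∫ z, rowForm u t z * rowForm u' t' z ∂rowLaw p = u ⬝ᵥ u' + t * t' := by
  have hi := integrable_rowForm_pow_mul_pow u u' t t'
  have h : ∀ z, rowForm u t z * rowForm u' t' z =
      (rowForm (u + u') (t + t') z ^ (2 * 1) - rowForm (u - u') (t - t') z ^ (2 * 1)) / 4 :=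
    fun z => by rw [rowForm_add, rowForm_sub]; ring
  simp_rw [h]
  rw [integral_div, integral_sub, integral_rowForm_pow, integral_rowForm_pow, mul_one,
    integral_pow_two_stdGaussian, sqNorm_add, sqNorm_sub]
  · ring
  · simpa using integrable_rowForm_pow_mul_pow (u + u') 0 (t + t') 0 2 0
  · simpa using integrable_rowForm_pow_mul_pow (u - u') 0 (t - t') 0 2 0

/-- Wick's formula for two forms, by the quartic polarisation 12a²b² = (a+b)⁴ + (a-b)⁴ - 2a⁴ - 2b⁴.
-/
theorem integral_rowForm_sq_mul_sq :
    ∫ z, rowForm u t z ^ 2 * rowForm u' t' z ^ 2 ∂rowLaw p =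
      (sqNorm u + t ^ 2) * (sqNorm u' + t' ^ 2) + 2 * (u ⬝ᵥ u' + t * t') ^ 2 := by
  have h : ∀ z, rowForm u t z ^ 2 * rowForm u' t' z ^ 2 =
      (rowForm (u + u') (t + t') z ^ (2 * 2) + rowForm (u - u') (t - t') z ^ (2 * 2)
        - 2 * rowForm u t z ^ (2 * 2) - 2 * rowForm u' t' z ^ (2 * 2)) / 12 :=
    fun z => by rw [rowForm_add, rowForm_sub]; ring
  have hi : ∀ (u : Fin p → ℝ) t, Integrable (fun z => rowForm u t z ^ (2 * 2)) (rowLaw p) :=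
    fun u t => by simpa using integrable_rowForm_pow_mul_pow u 0 t 0 4 0
  simp_rw [h]
  rw [integral_div, integral_sub (((hi _ _).fun_add (hi _ _)).fun_sub ((hi _ _).const_mul 2))
      ((hi _ _).const_mul 2), integral_sub ((hi _ _).fun_add (hi _ _)) ((hi _ _).const_mul 2),
    integral_add (hi _ _) (hi _ _), integral_const_mul, integral_const_mul]
  simp_rw [integral_rowForm_pow]
  norm_num only
  rw [integral_pow_four_stdGaussian, sqNorm_add, sqNorm_sub]
  ring

end RowForm

/-! ### Moments of the score and of the diagonal term. -/

section RowMoments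

variable {p : ℕ} (β : Fin p → ℝ) (t : ℝ)

theorem rowForm_single (k : Fin p) (z : (Fin p → ℝ) × ℝ) : rowForm (Pi.single k 1) 0 z = z.1 k := by
  simp [rowForm]

theorem sqNorm_single (k : Fin p) : sqNorm (Pi.single k 1 : Fin p → ℝ) = 1 := by
  simp [sqNorm, Pi.single_apply]

theorem sqNorm_nonneg {m : ℕ} (u : Fin m → ℝ) : 0 ≤ sqNorm u :=
  Finset.sum_nonneg fun _ _ => sq_nonneg _

theorem dotProduct_self_eq_sqNorm {m : ℕ} (u : Fin m → ℝ) : u ⬝ᵥ u = sqNorm u := by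
  simp [sqNorm, dotProduct, sq]

theorem dotProduct_sq_le {m : ℕ} (u v : Fin m → ℝ) : (u ⬝ᵥ v) ^ 2 ≤ sqNorm u * sqNorm v :=
  Finset.sum_mul_sq_le_sq_mul_sq _ _ _

/-- The centred product `y x - β` of a response with its row. -/
def centredScore (z : (Fin p → ℝ) × ℝ) (k : Fin p) : ℝ := rowForm β t z * z.1 k - β k

/-- The diagonal part of the error of Dicker's estimator in a sample of size `n`. -/
def diagTerm (n : ℕ) (z : (Fin p → ℝ) × ℝ) : ℝ :=
  rowForm β t z ^ 2 * sqNorm z.1 + 2 * (n - 1) * (rowForm β t z * rowForm β 0 z)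
    - (p + n + 1) * rowForm β t z ^ 2 + ((1 - n) * sqNorm β + (n + 1) * t ^ 2)

/-- This is the form that arises when ‖XᵀY‖² is expanded; the defining form is the one suited to
computing moments. -/
theorem diagTerm_eq (n : ℕ) (z : (Fin p → ℝ) × ℝ) :
    diagTerm β t n z = ∑ k, centredScore β t z k ^ 2 + 2 * n * ∑ k, β k * centredScore β t z k
      - (p + n + 1) * rowForm β t z ^ 2 + n * sqNorm β + (n + 1) * t ^ 2 := by
  have h1 : ∑ k, centredScore β t z k ^ 2 =
      rowForm β t z ^ 2 * sqNorm z.1 - 2 * (rowForm β t z * rowForm β 0 z) + sqNorm β := by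
    simp only [centredScore, sub_sq, Finset.sum_add_distrib, Finset.sum_sub_distrib, sqNorm,
      Finset.mul_sum, mul_pow, rowForm, dotProduct, zero_mul, add_zero]
    congr 2
    exact Finset.sum_congr rfl fun k _ => by ring
  have h2 : ∑ k, β k * centredScore β t z k = rowForm β t z * rowForm β 0 z - sqNorm β := by
    simp only [centredScore, mul_sub, Finset.sum_sub_distrib, sqNorm, Finset.mul_sum, rowForm,
      dotProduct, zero_mul, add_zero]
    congr 1
    · exact Finset.sum_congr rfl fun k _ => by ring
    · exact Finset.sum_congr rfl fun k _ => by ring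
  rw [h1, h2, diagTerm]
  ring

theorem memLp_rowForm_mul (u u' : Fin p → ℝ) (t t' : ℝ) :
    MemLp (fun z => rowForm u t z * rowForm u' t' z) 2 (rowLaw p) := by
  rw [memLp_two_iff_integrable_sq (by fun_prop)]
  simpa only [mul_pow] using integrable_rowForm_pow_mul_pow u u' t t' 2 2

theorem memLp_rowForm_sq_mul_sq (u u' : Fin p → ℝ) (t t' : ℝ) :
    MemLp (fun z => rowForm u t z ^ 2 * rowForm u' t' z ^ 2) 2 (rowLaw p) := by
  rw [memLp_two_iff_integrable_sq (by fun_prop)]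
  simpa only [mul_pow, ← pow_mul] using integrable_rowForm_pow_mul_pow u u' t t' 4 4

theorem rowForm_sq_mul_sqNorm (z : (Fin p → ℝ) × ℝ) :
    rowForm β t z ^ 2 * sqNorm z.1 =
      ∑ k, rowForm β t z ^ 2 * rowForm (Pi.single k 1) 0 z ^ 2 := by
  simp [rowForm_single, sqNorm, Finset.mul_sum]

theorem memLp_rowForm_sq_mul_sqNorm :
    MemLp (fun z => rowForm β t z ^ 2 * sqNorm z.1) 2 (rowLaw p) := by
  simp_rw [rowForm_sq_mul_sqNorm]
  exact memLp_finsetSum _ fun k _ => memLp_rowForm_sq_mul_sq _ _ _ _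

theorem integral_rowForm_sq_mul_sqNorm :
    ∫ z, rowForm β t z ^ 2 * sqNorm z.1 ∂rowLaw p =
      p * (sqNorm β + t ^ 2) + 2 * sqNorm β := by
  simp_rw [rowForm_sq_mul_sqNorm]
  rw [integral_finsetSum _ fun k _ => (memLp_rowForm_sq_mul_sq _ _ _ _).integrable (by norm_num)]
  simp_rw [integral_rowForm_sq_mul_sq, sqNorm_single]
  simp [Finset.sum_add_distrib, ← Finset.mul_sum, sqNorm]
  ring

theorem memLp_rowForm_sq : MemLp (fun z => rowForm β t z ^ 2) 2 (rowLaw p) := by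
  simpa only [sq] using memLp_rowForm_mul β β t t

theorem integral_rowForm_sq : ∫ z, rowForm β t z ^ 2 ∂rowLaw p = sqNorm β + t ^ 2 := by
  simpa [integral_pow_two_stdGaussian] using integral_rowForm_pow β t 1

theorem memLp_centredScore (k : Fin p) : MemLp (fun z => centredScore β t z k) 2 (rowLaw p) := by
  simp only [centredScore, ← rowForm_single k]
  exact (memLp_rowForm_mul _ _ _ _).sub (memLp_const _)

theorem integral_centredScore (k : Fin p) : ∫ z, centredScore β t z k ∂rowLaw p = 0 := by
  simp only [centredScore, ← rowForm_single k]
  rw [integral_sub ((memLp_rowForm_mul _ _ _ _).integrable (by norm_num)) (integrable_const _),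
    integral_rowForm_mul]
  simp

/-- The exact value is (‖β‖² + t²)‖u‖² + ⟨β, u⟩². What matters is that the covariance norm does not
grow with `p`, unlike the trace. -/
theorem integral_centredScore_dotProduct_sq_le (u : Fin p → ℝ) :
    ∫ z, (∑ k, centredScore β t z k * u k) ^ 2 ∂rowLaw p ≤
      3 * (sqNorm β + t ^ 2) * ∑ k, u k ^ 2 := by
  have h : ∀ z, ∑ k, centredScore β t z k * u k = rowForm β t z * rowForm u 0 z - β ⬝ᵥ u := by
    intro z
    simp only [centredScore, sub_mul, Finset.sum_sub_distrib, rowForm, dotProduct, zero_mul,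
      add_zero, Finset.mul_sum]
    congr 1
    exact Finset.sum_congr rfl fun k _ => by ring
  have hm := memLp_rowForm_mul β u t 0
  have hsq : ∀ z, (∑ k, centredScore β t z k * u k) ^ 2 = rowForm β t z ^ 2 * rowForm u 0 z ^ 2
      - (2 * β ⬝ᵥ u) * (rowForm β t z * rowForm u 0 z) + (β ⬝ᵥ u) ^ 2 := fun z => by rw [h]; ring
  have h2 := (memLp_rowForm_sq_mul_sq β u t 0).integrable (by norm_num)
  have h1 := hm.integrable (by norm_num)
  simp_rw [hsq]
  rw [integral_add (h2.fun_sub (h1.const_mul _)) (integrable_const _), integral_sub h2 (h1.const_mul _),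
    integral_const_mul, integral_rowForm_sq_mul_sq, integral_rowForm_mul]
  have hc := dotProduct_sq_le β u
  have hu := sqNorm_nonneg u
  change _ ≤ 3 * (sqNorm β + t ^ 2) * sqNorm u
  simp only [integral_const, probReal_univ, one_smul]
  nlinarith [mul_nonneg (sq_nonneg t) hu]

theorem sum_integral_centredScore_sq :
    ∑ k, ∫ z, centredScore β t z k ^ 2 ∂rowLaw p = p * (sqNorm β + t ^ 2) + sqNorm β := by
  have h : ∀ k, ∫ z, centredScore β t z k ^ 2 ∂rowLaw p = (sqNorm β + t ^ 2) + β k ^ 2 := by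
    intro k
    simp only [centredScore, ← rowForm_single k]
    have h2 := (memLp_rowForm_sq_mul_sq β (Pi.single k 1) t 0).integrable (by norm_num)
    have h1 := (memLp_rowForm_mul β (Pi.single k 1) t 0).integrable (by norm_num)
    have hsq : ∀ z, (rowForm β t z * rowForm (Pi.single k 1) 0 z - β k) ^ 2 =
        rowForm β t z ^ 2 * rowForm (Pi.single k 1) 0 z ^ 2
          - (2 * β k) * (rowForm β t z * rowForm (Pi.single k 1) 0 z) + β k ^ 2 :=
      fun z => by ring
    simp_rw [hsq]
    rw [integral_add (h2.fun_sub (h1.const_mul _)) (integrable_const _),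
      integral_sub h2 (h1.const_mul _), integral_const_mul, integral_rowForm_sq_mul_sq,
      integral_rowForm_mul, sqNorm_single]
    simp
    ring
  simp_rw [h]
  simp [Finset.sum_add_distrib, sqNorm]
  ring

theorem memLp_diagTerm (n : ℕ) : MemLp (diagTerm β t n) 2 (rowLaw p) :=
  (((memLp_rowForm_sq_mul_sqNorm β t).add ((memLp_rowForm_mul β β t 0).const_mul _)).sub
    ((memLp_rowForm_sq β t).const_mul _)).add (memLp_const _)

/-- This cancellation is the unbiasedness of Dicker's estimator; its coefficients are tuned for it.
-/
theorem integral_diagTerm (n : ℕ) : ∫ z, diagTerm β t n z ∂rowLaw p = 0 := by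
  have h1 := (memLp_rowForm_sq_mul_sqNorm β t).integrable (by norm_num)
  have h2 := (memLp_rowForm_mul β β t 0).integrable (by norm_num)
  have h3 := (memLp_rowForm_sq β t).integrable (by norm_num)
  unfold diagTerm
  rw [integral_add ((h1.fun_add (h2.const_mul _)).fun_sub (h3.const_mul _)) (integrable_const _),
    integral_sub (h1.fun_add (h2.const_mul _)) (h3.const_mul _), integral_add h1 (h2.const_mul _),
    integral_const_mul, integral_const_mul, integral_rowForm_sq_mul_sqNorm, integral_rowForm_mul,
    integral_rowForm_sq, dotProduct_self_eq_sqNorm]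
  simp
  ring

/-- Cauchy–Schwarz over the `p` coordinates, then a⁴b⁴ ≤ a⁸ + b⁸. The eighth Gaussian moment stays
an unevaluated constant. -/
theorem integral_rowForm_pow_four_mul_sqNorm_sq_le :
    ∫ z, (rowForm β t z ^ 2 * sqNorm z.1) ^ 2 ∂rowLaw p ≤
      p ^ 2 * ((∫ x, x ^ 8 ∂gaussianReal 0 1) * ((sqNorm β + t ^ 2) ^ 4 + 1)) := by
  have hi : ∀ (u : Fin p → ℝ) t, Integrable (fun z => rowForm u t z ^ 8) (rowLaw p) :=
    fun u t => by simpa using integrable_rowForm_pow_mul_pow u 0 t 0 8 0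
  calc _ ≤ ∫ z, ∑ k : Fin p, p * (rowForm β t z ^ 8 + rowForm (Pi.single k 1) 0 z ^ 8) ∂rowLaw p := by
        refine integral_mono (memLp_rowForm_sq_mul_sqNorm β t).integrable_sq
          (integrable_finsetSum _ fun k _ => ((hi _ _).fun_add (hi _ _)).const_mul _) fun z => ?_
        rw [rowForm_sq_mul_sqNorm]
        refine sq_sum_le_card_mul_sum_sq.trans ?_
        rw [Finset.card_univ, Fintype.card_fin, Finset.mul_sum]
        gcongr with k
        nlinarith [sq_nonneg (rowForm β t z ^ 4 - rowForm (Pi.single k 1) 0 z ^ 4),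
          sq_nonneg (rowForm β t z ^ 4 + rowForm (Pi.single k 1) 0 z ^ 4)]
    _ = _ := by
        rw [integral_finsetSum _ fun k _ => ((hi _ _).fun_add (hi _ _)).const_mul _]
        simp_rw [integral_const_mul, integral_add (hi _ _) (hi _ _)]
        have h8 := fun (u : Fin p → ℝ) t => integral_rowForm_pow u t 4
        norm_num only at h8
        simp_rw [h8, sqNorm_single]
        simp
        ring

theorem integral_diagTerm_sq_le {n : ℕ} (hn : 1 ≤ n) :
    ∫ z, diagTerm β t n z ^ 2 ∂rowLaw p ≤ 5 * (p + n + 1) ^ 2 *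
      ((∫ x, x ^ 8 ∂gaussianReal 0 1) * ((sqNorm β + t ^ 2) ^ 4 + 1)
        + 17 * (sqNorm β + t ^ 2) ^ 2) := by
  have hn' : (1 : ℝ) ≤ n := by exact_mod_cast hn
  have i1 := (memLp_rowForm_sq_mul_sqNorm β t).integrable_sq
  have i2 := (memLp_rowForm_sq_mul_sq β β t 0).integrable (by norm_num)
  have i3 := (memLp_rowForm_sq_mul_sq β β t t).integrable (by norm_num)
  have hb := sqNorm_nonneg β
  set N := sqNorm β + t ^ 2 with hN
  have hbN : sqNorm β ≤ N := by nlinarith [sq_nonneg t]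
  have htN : t ^ 2 ≤ N := by linarith
  have hb2 : sqNorm β ^ 2 ≤ N ^ 2 := by gcongr
  have ht2 : (t ^ 2) ^ 2 ≤ N ^ 2 := by gcongr
  have hbm : sqNorm β * N ≤ N ^ 2 := by nlinarith
  set m := ∫ x, x ^ 8 ∂gaussianReal 0 1
  have hm : 0 ≤ m := integral_nonneg fun x => by positivity
  set D : ℝ := p + n + 1 with hD
  have hnD : (n : ℝ) ^ 2 ≤ D ^ 2 := by
    have : (0 : ℝ) ≤ p := by positivity
    gcongr
    linarith
  have hpD : (p : ℝ) ^ 2 ≤ D ^ 2 := by gcongr; linarith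
  have hn1 : (n - 1 : ℝ) ^ 2 ≤ D ^ 2 := by nlinarith
  have hn2 : (n + 1 : ℝ) ^ 2 ≤ D ^ 2 := by
    have : (0 : ℝ) ≤ p := by positivity
    gcongr
    linarith
  calc _ ≤ ∫ z, (5 * (rowForm β t z ^ 2 * sqNorm z.1) ^ 2
          + 5 * (4 * D ^ 2) * (rowForm β t z ^ 2 * rowForm β 0 z ^ 2)
          + 5 * D ^ 2 * (rowForm β t z ^ 2 * rowForm β t z ^ 2) + 10 * D ^ 2 * N ^ 2) ∂rowLaw p := by
        refine integral_mono (memLp_diagTerm β t n).integrable_sq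
          ((((i1.const_mul _).fun_add (i2.const_mul _)).fun_add (i3.const_mul _)).fun_add
            (integrable_const _)) fun z => ?_
        -- Cauchy–Schwarz for five terms. The resulting N² coefficients are 60, 15 and 10, which sum
        -- to 5 · 17.
        have h5 : ∀ a b c d e : ℝ, (a + b - c + (d + e)) ^ 2 ≤
            5 * (a ^ 2 + b ^ 2 + c ^ 2 + d ^ 2 + e ^ 2) := fun a b c d e => by
          nlinarith [sq_nonneg (a - b), sq_nonneg (a + c), sq_nonneg (a - d), sq_nonneg (a - e),
            sq_nonneg (b + c), sq_nonneg (b - d), sq_nonneg (b - e), sq_nonneg (c + d),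
            sq_nonneg (c + e), sq_nonneg (d - e)]
        refine (h5 _ _ _ _ _).trans ?_
        have e1 : (2 * (n - 1 : ℝ) * (rowForm β t z * rowForm β 0 z)) ^ 2 ≤
            4 * D ^ 2 * (rowForm β t z ^ 2 * rowForm β 0 z ^ 2) := by
          rw [mul_pow, mul_pow, mul_pow]
          norm_num only
          gcongr
        have e2 : ((1 - n : ℝ) * sqNorm β) ^ 2 ≤ D ^ 2 * N ^ 2 := by
          rw [mul_pow, ← neg_sub, neg_sq]
          gcongr
        have e3 : ((n + 1 : ℝ) * t ^ 2) ^ 2 ≤ D ^ 2 * N ^ 2 := by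
          rw [mul_pow]
          gcongr
        have e4 : (D * rowForm β t z ^ 2) ^ 2 = D ^ 2 * (rowForm β t z ^ 2 * rowForm β t z ^ 2) := by
          ring
        linarith
    _ ≤ _ := by
        rw [integral_add (((i1.const_mul _).fun_add (i2.const_mul _)).fun_add (i3.const_mul _))
            (integrable_const _), integral_add ((i1.const_mul _).fun_add (i2.const_mul _))
            (i3.const_mul _), integral_add (i1.const_mul _) (i2.const_mul _), integral_const_mul,
          integral_const_mul, integral_const_mul, integral_rowForm_sq_mul_sq,
          integral_rowForm_sq_mul_sq]
        simp only [dotProduct_self_eq_sqNorm, ← sq, ← hN, integral_const, probReal_univ, one_smul]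
        have h1 := integral_rowForm_pow_four_mul_sqNorm_sq_le β t
        have h2 : (p : ℝ) ^ 2 * (m * (N ^ 4 + 1)) ≤ D ^ 2 * (m * (N ^ 4 + 1)) := by gcongr
        have h3 : D ^ 2 * (N * (sqNorm β + 0 ^ 2) + 2 * (sqNorm β + t * 0) ^ 2) ≤
            D ^ 2 * (3 * N ^ 2) := by
          gcongr
          nlinarith
        nlinarith

theorem integral_pairStat_diagTerm_sq_le {n : ℕ} (hn : 1 ≤ n) :
    ∫ z : Fin n → (Fin p → ℝ) × ℝ, pairStat (diagTerm β t n) (centredScore β t) z ^ 2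
        ∂(Measure.pi fun _ => rowLaw p) ≤
      n * (p + n + 1) ^ 2 * (10 * ((∫ x, x ^ 8 ∂gaussianReal 0 1) * ((sqNorm β + t ^ 2) ^ 4 + 1))
        + 182 * (sqNorm β + t ^ 2) ^ 2) := by
  have hb := sqNorm_nonneg β
  have hN : 0 ≤ sqNorm β + t ^ 2 := by positivity
  have h := integral_pairStat_sq_le (memLp_diagTerm β t n) (integral_diagTerm β t n)
    (memLp_centredScore β t) (integral_centredScore β t) (by positivity)
    (integral_centredScore_dotProduct_sq_le β t) (sum_integral_centredScore_sq β t).le n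
  have h1 := mul_le_mul_of_nonneg_left (integral_diagTerm_sq_le β t hn)
    (by positivity : 0 ≤ 2 * (n : ℝ))
  have hn' : (0 : ℝ) ≤ n := by positivity
  have hp' : (0 : ℝ) ≤ p := by positivity
  have hB : p * (sqNorm β + t ^ 2) + sqNorm β ≤ (p + n + 1) * (sqNorm β + t ^ 2) := by
    nlinarith [sq_nonneg t, mul_nonneg hn' hN]
  have hnD : (n : ℝ) ^ 2 ≤ n * (p + n + 1) := by nlinarith [mul_nonneg hn' hp']
  -- Brings the off-diagonal part to the scale n(p+n+1)² of the diagonal one; 182 is 2 · 85 from the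
  -- diagonal plus 12 from here.
  have h2 : 4 * (n : ℝ) ^ 2 * (3 * (sqNorm β + t ^ 2)) * (p * (sqNorm β + t ^ 2) + sqNorm β) ≤
      4 * (n * (p + n + 1)) * (3 * (sqNorm β + t ^ 2)) * ((p + n + 1) * (sqNorm β + t ^ 2)) := by
    gcongr
  linarith

end RowMoments

theorem measureReal_ge_le_of_lintegral_le {α : Type*} [MeasurableSpace α] {μ : Measure α}
    {G : α → ENNReal} (hG : Measurable G) {r a : ℝ} (hr : 0 ≤ r) (ha : 0 < a)
    (h : ∫⁻ x, G x ∂μ ≤ ENNReal.ofReal r) :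
    μ.real {x | ENNReal.ofReal a ≤ G x} ≤ r / a := by
  have h1 := (mul_meas_ge_le_lintegral (μ := μ) hG (ENNReal.ofReal a)).trans h
  have h2 := ENNReal.toReal_mono ENNReal.ofReal_ne_top h1
  rw [ENNReal.toReal_mul, ENNReal.toReal_ofReal ha.le, ENNReal.toReal_ofReal hr] at h2
  rw [le_div_iff₀ ha, mul_comm]
  exact h2

/-! ### Mean square error of Dicker's estimator. -/

section Dicker

variable {n p : ℕ} (β : Fin p → ℝ) (s : ℝ≥0)

theorem measurable_matrix_apply (i : Fin n) (k : Fin p) :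
    Measurable fun X : Matrix (Fin n) (Fin p) ℝ => X i k :=
  (measurable_pi_apply k).comp (measurable_pi_apply (X := fun _ : Fin n => Fin p → ℝ) i)

theorem measurable_dickerEstimator :
    Measurable fun q : Matrix (Fin n) (Fin p) ℝ × (Fin n → ℝ) => dickerEstimator q.1 q.2 := by
  have h : ∀ i k, Measurable fun q : Matrix (Fin n) (Fin p) ℝ × (Fin n → ℝ) => q.1 i k :=
    fun i k => (measurable_matrix_apply i k).comp measurable_fst
  simp only [dickerEstimator, sqNorm, Matrix.mulVec, dotProduct, Matrix.transpose_apply]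
  fun_prop

/-- The responses as a function of the design and of the standardised noise. -/
noncomputable def response (X : Matrix (Fin n) (Fin p) ℝ) (e : Fin n → ℝ) (i : Fin n) : ℝ :=
  rowForm β √(s : ℝ) (X i, e i)

theorem measurable_response :
    Measurable fun q : Matrix (Fin n) (Fin p) ℝ × (Fin n → ℝ) => response β s q.1 q.2 := by
  have h : ∀ i k, Measurable fun q : Matrix (Fin n) (Fin p) ℝ × (Fin n → ℝ) => q.1 i k :=
    fun i k => (measurable_matrix_apply i k).comp measurable_fst
  refine measurable_pi_lambda _ fun i => ?_
  simp only [response, rowForm, dotProduct]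
  fun_prop

theorem condLaw_eq_map (X : Matrix (Fin n) (Fin p) ℝ) :
    condLaw X β s = (Measure.pi fun _ : Fin n => gaussianReal 0 1).map (response β s X) := by
  have h : ∀ i, gaussianReal ((X *ᵥ β) i) s =
      (gaussianReal 0 1).map fun e => (X *ᵥ β) i + √(s : ℝ) * e := fun i => by
    have h2 := Measure.map_map (μ := gaussianReal 0 1) (measurable_const_add ((X *ᵥ β) i))
      (measurable_const_mul √(s : ℝ))
    rw [gaussianReal_map_const_mul, gaussianReal_map_const_add] at h2
    refine Eq.trans ?_ h2
    congr 1
    · simp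
    · ext; simp
  simp only [condLaw, h]
  have hr : response β s X = fun e i => (X *ᵥ β) i + √(s : ℝ) * e i := by
    ext e i
    simp [response, rowForm, Matrix.mulVec, dotProduct_comm]
  rw [hr, Measure.pi_map_pi (μ := fun _ : Fin n => gaussianReal 0 1)
    (f := fun i e => (X *ᵥ β) i + √(s : ℝ) * e) fun i => by fun_prop]

theorem lintegral_condLaw (X : Matrix (Fin n) (Fin p) ℝ)
    {F : Matrix (Fin n) (Fin p) ℝ × (Fin n → ℝ) → ENNReal} (hF : Measurable F) :
    ∫⁻ Y, F (X, Y) ∂condLaw X β s =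
      ∫⁻ e, F (X, response β s X e) ∂Measure.pi fun _ : Fin n => gaussianReal 0 1 := by
  rw [condLaw_eq_map]
  exact lintegral_map (hF.comp measurable_prodMk_left)
    ((measurable_response β s).comp measurable_prodMk_left)

theorem measurable_lintegral_condLaw
    {F : Matrix (Fin n) (Fin p) ℝ × (Fin n → ℝ) → ENNReal} (hF : Measurable F) :
    Measurable fun X => ∫⁻ Y, F (X, Y) ∂condLaw X β s := by
  simp_rw [lintegral_condLaw β s _ hF]
  exact Measurable.lintegral_prod_right' (f := fun q : Matrix (Fin n) (Fin p) ℝ × (Fin n → ℝ) =>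
    F (q.1, response β s q.1 q.2)) (hF.comp (measurable_fst.prodMk (measurable_response β s)))

/-- Tonelli, followed by regrouping the rows and the noise into `n` i.i.d. pairs, to which the
bounds on `pairStat` apply. -/
theorem lintegral_designLaw_condLaw
    {F : Matrix (Fin n) (Fin p) ℝ × (Fin n → ℝ) → ENNReal} (hF : Measurable F) :
    ∫⁻ X, ∫⁻ Y, F (X, Y) ∂condLaw X β s ∂designLaw n p =
      ∫⁻ z : Fin n → (Fin p → ℝ) × ℝ,
        F (Matrix.of fun i => (z i).1, fun i => rowForm β √(s : ℝ) (z i)) ∂Measure.pi fun _ => rowLaw p := by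
  have hm : Measurable fun q : Matrix (Fin n) (Fin p) ℝ × (Fin n → ℝ) =>
      F (q.1, response β s q.1 q.2) := hF.comp (measurable_fst.prodMk (measurable_response β s))
  simp_rw [lintegral_condLaw β s _ hF]
  rw [← lintegral_prod (fun q : Matrix (Fin n) (Fin p) ℝ × (Fin n → ℝ) =>
      F (q.1, response β s q.1 q.2)) hm.aemeasurable]
  exact ((measurePreserving_arrowProdEquivProdArrow (Fin p → ℝ) ℝ (Fin n)
    (fun _ => Measure.pi fun _ : Fin p => gaussianReal 0 1) fun _ => gaussianReal 0 1).lintegral_comp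
      hm).symm

theorem dickerEstimator_sub_eq (hn : 1 ≤ n) (t : ℝ) (z : Fin n → (Fin p → ℝ) × ℝ) :
    dickerEstimator (Matrix.of fun i => (z i).1) (fun i => rowForm β t (z i)) - t ^ 2 =
      -(pairStat (diagTerm β t n) (centredScore β t) z / (n * (n + 1))) := by
  have hn' : (n : ℝ) ≠ 0 := by positivity
  have hn1 : (n : ℝ) + 1 ≠ 0 := by positivity
  have h : ∀ k, ∑ i, (z i).1 k * rowForm β t (z i) =
      ∑ i, centredScore β t (z i) k + n * β k := by
    intro k
    simp [centredScore, mul_comm]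
  have h1 : sqNorm ((Matrix.of fun i => (z i).1)ᵀ *ᵥ fun i => rowForm β t (z i)) =
      ∑ k, (∑ i, centredScore β t (z i) k) ^ 2
        + 2 * n * ∑ i, ∑ k, β k * centredScore β t (z i) k + n ^ 2 * sqNorm β := by
    simp only [sqNorm, Matrix.mulVec, dotProduct, Matrix.transpose_apply, Matrix.of_apply, h,
      add_sq, Finset.sum_add_distrib, mul_pow, ← Finset.mul_sum]
    rw [Finset.sum_comm]
    simp only [Finset.mul_sum]
    congr 2
    exact Finset.sum_congr rfl fun k _ => by
      rw [Finset.sum_mul]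
      exact Finset.sum_congr rfl fun i _ => by ring
  have h2 : sqNorm (fun i => rowForm β t (z i)) = ∑ i, rowForm β t (z i) ^ 2 := rfl
  rw [dickerEstimator, h1, h2, pairStat]
  simp only [diagTerm_eq, Finset.sum_add_distrib, Finset.sum_sub_distrib, ← Finset.mul_sum,
    Finset.sum_const, Finset.card_univ, Fintype.card_fin, nsmul_eq_mul]
  field_simp
  ring

/-- The mean square error of Dicker's estimator is `O(1/n)`, locally uniformly in `p/n`, in the
norm of `β` and in the noise variance. -/
theorem lintegral_dickerEstimator_sub_sq_le (hn : 1 ≤ n) {a N : ℝ} (ha : (p : ℝ) + n + 1 ≤ a * (n + 1))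
    (hN : sqNorm β + s ≤ N) :
    ∫⁻ X, ∫⁻ Y, ENNReal.ofReal ((dickerEstimator X Y - s) ^ 2) ∂condLaw X β s ∂designLaw n p ≤
      ENNReal.ofReal (a ^ 2 * (10 * ((∫ x, x ^ 8 ∂gaussianReal 0 1) * (N ^ 4 + 1)) + 182 * N ^ 2)
        / n) := by
  have hs : √(s : ℝ) ^ 2 = s := Real.sq_sqrt s.coe_nonneg
  have hm : Measurable fun q : Matrix (Fin n) (Fin p) ℝ × (Fin n → ℝ) =>
      ENNReal.ofReal ((dickerEstimator q.1 q.2 - s) ^ 2) :=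
    ((measurable_dickerEstimator.sub_const _).pow_const 2).ennreal_ofReal
  have hmem := memLp_pairStat (memLp_diagTerm β √(s : ℝ) n) (memLp_centredScore β √(s : ℝ)) n
  have hn0 : (0 : ℝ) < n := by exact_mod_cast hn
  have hm8 : 0 ≤ ∫ x, x ^ 8 ∂gaussianReal 0 1 := integral_nonneg fun x => by positivity
  have hN0 : 0 ≤ sqNorm β + s := add_nonneg (sqNorm_nonneg β) s.coe_nonneg
  rw [lintegral_designLaw_condLaw β s hm]
  have heq : ∀ z : Fin n → (Fin p → ℝ) × ℝ,
      (dickerEstimator (Matrix.of fun i => (z i).1) (fun i => rowForm β √(s : ℝ) (z i))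
        - s) ^ 2 = pairStat (diagTerm β √(s : ℝ) n) (centredScore β √(s : ℝ)) z ^ 2 /
          (n * (n + 1)) ^ 2 := fun z => by
    have h := dickerEstimator_sub_eq β hn √(s : ℝ) z
    rw [hs] at h
    rw [h, neg_sq, div_pow]
  simp_rw [heq]
  rw [← ofReal_integral_eq_lintegral_ofReal (hmem.integrable_sq.div_const _)
    (ae_of_all _ fun z => by positivity), integral_div]
  refine ENNReal.ofReal_le_ofReal ?_
  rw [div_le_div_iff₀ (by positivity) hn0]
  refine (mul_le_mul_of_nonneg_right (integral_pairStat_diagTerm_sq_le β _ hn) hn0.le).trans ?_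
  rw [hs]
  calc _ ≤ n * (a * (n + 1)) ^ 2 * (10 * ((∫ x, x ^ 8 ∂gaussianReal 0 1) * (N ^ 4 + 1))
        + 182 * N ^ 2) * n := by gcongr
    _ = _ := by ring

end Dicker

/-! ### The decision rule and the theorem. -/

theorem abs_sub_ge_of_dickerRule_ne {n p : ℕ} {s₀ s₁ : ℝ≥0} {J : Fin 2}
    {X : Matrix (Fin n) (Fin p) ℝ} {Y : Fin n → ℝ} (h : dickerRule s₀ s₁ X Y ≠ J) :
    ((s₁ : ℝ) - s₀) / 2 ≤ |dickerEstimator X Y - (![s₀, s₁] J : ℝ≥0)| := by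
  unfold dickerRule at h
  fin_cases J
  · have h' : ((s₀ : ℝ) + s₁) / 2 < dickerEstimator X Y := by
      by_contra hc
      simp [hc] at h
    simp only [Fin.zero_eta, Matrix.cons_val_zero]
    exact le_trans (by linarith) (le_abs_self _)
  · have h' : ¬ ((s₀ : ℝ) + s₁) / 2 < dickerEstimator X Y := fun hc => by simp [hc] at h
    simp only [Fin.mk_one, Matrix.cons_val_one]
    exact le_trans (by simp at h' ⊢; linarith) (neg_le_abs _)

theorem one_le_gBound {c : ℝ} (hc : 1 ≤ c) (n : ℕ) (μ : Fin n → ℝ) (s : ℝ≥0) :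
    1 ≤ gBound c n μ s := by
  have h := sqNorm_nonneg μ
  have h1 : 0 ≤ 2 * (c + 1) * ((1 / (n : ℝ) * sqNorm μ) ^ 2 + (s : ℝ) ^ 2) := by positivity
  have h2 : 0 ≤ 4 * (s : ℝ) / (n : ℝ) * sqNorm μ := by positivity
  unfold gBound
  linarith [sq_nonneg (s : ℝ)]

theorem theorem1 (c : ℝ) (hc : 1 ≤ c) (p : ℕ → ℕ)
    (hp : Tendsto (fun n : ℕ => (p n : ℝ) / (n : ℝ)) atTop (𝓝 c)) :
    ∃ C : ℝ, ∀ (β : ∀ n : ℕ, Fin (p n) → ℝ) (s : ℕ → ℝ≥0),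
      (∃ M : ℝ, ∀ n, sqNorm (β n) ≤ M) → (∃ M : ℝ, ∀ n, (s n : ℝ) ≤ M) →
      ∃ A : ∀ n : ℕ, Set (Matrix (Fin n) (Fin (p n)) ℝ),
        (∀ n, MeasurableSet (A n)) ∧
        Tendsto (fun n => (designLaw n (p n)).real (A n)) atTop (𝓝 1) ∧
        (∀ n : ℕ, 1 ≤ n → ∀ X ∈ A n, ∀ ξ : ℝ, 0 < ξ →
          (condLaw X (β n) (s n)).real {Y | ξ ≤ |dickerEstimator X Y - (s n : ℝ)|}
            ≤ C * (gBound c n (X *ᵥ β n) (s n) / (ξ ^ 2 * √(n : ℝ)))) ∧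
        (∀ (s₀ s₁ : ℝ≥0) (J : Fin 2), s₀ < s₁ → (∀ n, s n = ![s₀, s₁] J) →
          (∃ K : ℝ, ∀ n : ℕ, 1 ≤ n → ∀ X ∈ A n,
            dickerRuleError s₀ s₁ J (β n) X ≤ K / √(n : ℝ)) ∧
          (∀ ε : ℝ, 0 < ε →
            Tendsto (fun n => (designLaw n (p n)).real
              {X | dickerRuleError s₀ s₁ J (β n) X ≤ ε}) atTop (𝓝 1))) := by
  obtain ⟨a, ha⟩ := hp.bddAbove_range
  have ha' : ∀ n : ℕ, 1 ≤ n → (p n : ℝ) + n + 1 ≤ (a + 1) * (n + 1) := fun n hn => by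
    have h1 : (p n : ℝ) / n ≤ a := ha ⟨n, rfl⟩
    have hn0 : (0 : ℝ) < n := by exact_mod_cast hn
    have h0 : 0 ≤ a := le_trans (by positivity) h1
    rw [div_le_iff₀ hn0] at h1
    linarith
  refine ⟨1, fun β s ⟨M₁, hM₁⟩ ⟨M₂, hM₂⟩ => ?_⟩
  have hG : ∀ n, Measurable fun q : Matrix (Fin n) (Fin (p n)) ℝ × (Fin n → ℝ) =>
      ENNReal.ofReal ((dickerEstimator q.1 q.2 - s n) ^ 2) := fun n =>
    ((measurable_dickerEstimator.sub_const _).pow_const 2).ennreal_ofReal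
  set G : ∀ n, Matrix (Fin n) (Fin (p n)) ℝ → ENNReal := fun n X =>
    ∫⁻ Y, ENNReal.ofReal ((dickerEstimator X Y - s n) ^ 2) ∂condLaw X (β n) (s n)
  have hGm : ∀ n, Measurable (G n) := fun n => measurable_lintegral_condLaw (β n) (s n) (hG n)
  -- The threshold 1/√n balances the two uses of Markov's inequality: K/n divided by it is K/√n, and
  -- the conditional bound also decays like 1/√n.
  set A : ∀ n, Set (Matrix (Fin n) (Fin (p n)) ℝ) :=
    fun n => {X | G n X ≤ ENNReal.ofReal (1 / √(n : ℝ))}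
  have hAm : ∀ n, MeasurableSet (A n) := fun n => measurableSet_le (hGm n) measurable_const
  set K := (a + 1) ^ 2 * (10 * ((∫ x, x ^ 8 ∂gaussianReal 0 1) * ((M₁ + M₂) ^ 4 + 1))
    + 182 * (M₁ + M₂) ^ 2) with hK
  have hK0 : 0 ≤ K := by
    have hm8 : 0 ≤ ∫ x, x ^ 8 ∂gaussianReal 0 1 := integral_nonneg fun x => by positivity
    positivity
  have hsqrt : Tendsto (fun n : ℕ => √(n : ℝ)) atTop atTop :=
    Real.tendsto_sqrt_atTop.comp tendsto_natCast_atTop_atTop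
  have hA1 : Tendsto (fun n => (designLaw n (p n)).real (A n)) atTop (𝓝 1) := by
    have hlow : Tendsto (fun n : ℕ => 1 - K / √(n : ℝ)) atTop (𝓝 1) := by
      simpa using (hsqrt.const_div_atTop K).const_sub 1
    refine tendsto_of_tendsto_of_tendsto_of_le_of_le' hlow tendsto_const_nhds ?_
      (Eventually.of_forall fun n => measureReal_le_one)
    filter_upwards [eventually_ge_atTop 1] with n hn
    have hn0 : (0 : ℝ) < n := by exact_mod_cast hn
    have hr : 0 < √(n : ℝ) := Real.sqrt_pos.2 hn0
    have h := measureReal_ge_le_of_lintegral_le (hGm n) (a := 1 / √(n : ℝ)) (by positivity)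
      (by positivity) (lintegral_dickerEstimator_sub_sq_le (β n) (s n) hn (ha' n hn)
        (add_le_add (hM₁ n) (hM₂ n)))
    have hcompl : (designLaw n (p n)).real (A n)ᶜ ≤ K / √(n : ℝ) := by
      refine (measureReal_mono fun X hX => ?_).trans (h.trans_eq ?_)
      · exact (lt_of_not_ge (show ¬ G n X ≤ _ from hX)).le
      · rw [← hK]
        field_simp
        rw [Real.sq_sqrt hn0.le]
    rw [probReal_compl_eq_one_sub (hAm n)] at hcompl
    linarith
  have hcheb : ∀ n : ℕ, 1 ≤ n → ∀ X ∈ A n, ∀ ξ : ℝ, 0 < ξ →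
      (condLaw X (β n) (s n)).real {Y | ξ ≤ |dickerEstimator X Y - (s n : ℝ)|} ≤
        1 / (ξ ^ 2 * √(n : ℝ)) := by
    intro n hn X hX ξ hξ
    have h := measureReal_ge_le_of_lintegral_le ((hG n).comp (measurable_prodMk_left (x := X)))
      (by positivity) (pow_pos hξ 2) hX
    refine (measureReal_mono fun Y hY => ?_).trans (h.trans_eq ?_)
    · refine ENNReal.ofReal_le_ofReal ?_
      rw [← sq_abs (_ - _)]
      exact pow_le_pow_left₀ hξ.le hY 2
    · rw [div_div, mul_comm]
  refine ⟨A, hAm, hA1, fun n hn X hX ξ hξ => ?_, fun s₀ s₁ J hs hJ => ?_⟩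
  · refine (hcheb n hn X hX ξ hξ).trans ?_
    rw [one_mul]
    gcongr
    exact one_le_gBound hc n _ _
  · have hgap : 0 < ((s₁ : ℝ) - s₀) / 2 := by
      have : (s₀ : ℝ) < s₁ := hs
      linarith
    have herr : ∀ n : ℕ, 1 ≤ n → ∀ X ∈ A n,
        dickerRuleError s₀ s₁ J (β n) X ≤ 1 / (((s₁ : ℝ) - s₀) / 2) ^ 2 / √(n : ℝ) := by
      intro n hn X hX
      rw [div_div]
      refine le_trans ?_ (hcheb n hn X hX _ hgap)
      rw [dickerRuleError, hJ n]
      exact measureReal_mono fun Y hY => abs_sub_ge_of_dickerRule_ne hY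
    refine ⟨⟨_, herr⟩, fun ε hε => ?_⟩
    refine tendsto_of_tendsto_of_tendsto_of_le_of_le' hA1 tendsto_const_nhds ?_
      (Eventually.of_forall fun n => measureReal_le_one)
    filter_upwards [eventually_ge_atTop 1, (hsqrt.const_div_atTop
      (1 / (((s₁ : ℝ) - s₀) / 2) ^ 2)).eventually_le_const hε] with n hn hnε
    exact measureReal_mono fun X hX => (herr n hn X hX).trans hnε
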